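/- Let $N\ge 2$ be an integer, let $\|\cdot\|$ be the Euclidean norm on $\mathbb R^N$, and let $W_N^A:=\{x\in\mathbb R^N:\ x_1>x_2>\dots>x_N\}$. Let $H_N$ be the Hermite polynomial of degree $N$ from the family orthogonal with respect to the density $e^{-x^2}$ on $\mathbb R$. Then $H_N$ has exactly $N$ distinct real zeros; let $z=(z_1,\dots,z_N)\in W_N^A$ be the vector of these zeros in decreasing order. For every $x_0\in W_N^A$, the initial value problem $$\frac{d x_i(t)}{dt}=\sum_{j\ne i}\frac{1}{x_i(t)-x_j(t)}\quad(i=1,\dots,N,\ t\ge 0),\qquad x(0)=x_0,$$ has a unique solution $x:[0,\infty)\to W_N^A$, and this solution has the form $$x(t)=\sqrt{N(N-1)\,t+\|x_0\|^2}\cdot\phi(t)\qquad(t\ge 0),$$ where $\phi$ satisfies $$\|\phi(t)\|=1\quad(t\ge0)\qquad\text{and}\qquad \lim_{t\to\infty}\phi(t)=\sqrt{\frac{2}{N(N-1)}}\cdot z .$$ -/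

import Mathlib

open Filter Topology

noncomputable section

/-- The open Weyl chamber `W_N^A` of type `A_{N-1}`: vectors `x` in Euclidean `ℝ^N` with
`x_1 > x_2 > ... > x_N`. -/
def openWeylChamberA (N : ℕ) : Set (EuclideanSpace ℝ (Fin N)) :=
  {x | StrictAnti fun i : Fin N => x i}

/-- The vector field `H(x)_i = ∑_{j ≠ i} 1 / (x_i - x_j)`. -/
def driftA (N : ℕ) (x : EuclideanSpace ℝ (Fin N)) : EuclideanSpace ℝ (Fin N) :=
  WithLp.toLp 2 fun i => ∑ j ∈ Finset.univ.erase i, 1 / (x i - x j)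

/-- `x` is a solution on `[0, ∞)`, with values in the open Weyl chamber, of
`x'(t) = H(x(t))`, `x(0) = x₀`. Only the values `x t` with `t ≥ 0` matter; the derivative at
`t = 0` is one-sided. -/
structure IsSolutionA (N : ℕ) (x₀ : EuclideanSpace ℝ (Fin N))
    (x : ℝ → EuclideanSpace ℝ (Fin N)) : Prop where
  init : x 0 = x₀
  mem : ∀ t : ℝ, 0 ≤ t → x t ∈ openWeylChamberA N
  ode : ∀ t : ℝ, 0 ≤ t → HasDerivWithinAt x (driftA N (x t)) (Set.Ici 0) t

/-- The Hermite polynomial `H_N(x) = 2^{N/2} He_N(√2 x)`, orthogonal with respect to the density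
`e^{-x²}`, in the standard normalization with leading coefficient `2^N`. Here `He_N` is Mathlib's
`Polynomial.hermite N`, which is monic and orthogonal with respect to `e^{-x²/2}`. -/
def hermiteH (N : ℕ) : Polynomial ℝ :=
  Polynomial.C (Real.sqrt 2 ^ N) *
    ((Polynomial.hermite N).map (Int.castRingHom ℝ)).comp
      (Polynomial.C (Real.sqrt 2) * Polynomial.X)

/-- `z` is the vector of the zeros of `H_N`, in strictly decreasing order. -/
def IsOrderedHermiteZeros (N : ℕ) (z : EuclideanSpace ℝ (Fin N)) : Prop :=
  z ∈ openWeylChamberA N ∧ ∀ r : ℝ, (hermiteH N).IsRoot r ↔ ∃ i : Fin N, z i = r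

end

/-! The drift `driftA` is the gradient of the concave function `∑_{i<j} log (x_i - x_j)` on the
chamber and is homogeneous of degree -1. Concavity makes distances between solutions nonincreasing
(`IsSolutionA.norm_sub_le`), hence uniqueness. Homogeneity gives `⟪x, driftA N x⟫ = N(N-1)/2`, so
`‖x t‖²` is affine in `t`. A fixed point `z` of the drift generates the solutions `√(2t+c) • z`;
every other solution stays at bounded distance from them while its norm tends to infinity, so its
direction converges to that of `z`. By Stieltjes' argument (`hermite_map_eq_prod`) the coordinates
of `z` are the zeros of `H_N`.

Existence of both solutions and `z` must avoid the singularity at collisions. The interaction `1/u`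
is frozen below a level `δ`; bounds on norm and potential independent of `δ` then keep all gaps
above a suitable `δ` (`exists_truncation_level`), where nothing was changed. -/

open scoped RealInnerProductSpace

/-! ### Pairwise interaction fields and their potentials -/

section GapField

variable {N : ℕ}

/-- The pairs of indices `(i, j)` with `i < j`. -/
def indexPairs (N : ℕ) : Finset (Fin N × Fin N) :=
  Finset.univ.filter fun p => p.1 < p.2

/-- The root vector `e_i - e_j`. -/
noncomputable def rootVector (p : Fin N × Fin N) : EuclideanSpace ℝ (Fin N) :=
  EuclideanSpace.single p.1 1 - EuclideanSpace.single p.2 1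

/-- The pairwise interaction field `∑_{i < j} f (x_i - x_j) (e_i - e_j)`. -/
noncomputable def gapField (f : ℝ → ℝ) (x : EuclideanSpace ℝ (Fin N)) : EuclideanSpace ℝ (Fin N) :=
  ∑ p ∈ indexPairs N, f (x p.1 - x p.2) • rootVector p

/-- The pairwise interaction potential `∑_{i < j} F (x_i - x_j)`. -/
noncomputable def gapPotential (F : ℝ → ℝ) (x : EuclideanSpace ℝ (Fin N)) : ℝ :=
  ∑ p ∈ indexPairs N, F (x p.1 - x p.2)

lemma mem_indexPairs {p : Fin N × Fin N} : p ∈ indexPairs N ↔ p.1 < p.2 := by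
  simp [indexPairs]

lemma mem_openWeylChamberA_iff {x : EuclideanSpace ℝ (Fin N)} :
    x ∈ openWeylChamberA N ↔ ∀ p ∈ indexPairs N, 0 < x p.1 - x p.2 := by
  constructor
  · intro h p hp
    exact sub_pos.2 (h (mem_indexPairs.1 hp))
  · intro h i j hij
    exact sub_pos.1 (h (i, j) (mem_indexPairs.2 hij))

lemma two_mul_card_indexPairs (N : ℕ) :
    2 * ((indexPairs N).card : ℝ) = (N : ℝ) * ((N : ℝ) - 1) := by
  have h : (indexPairs N).card = ∑ i : Fin N, (i : ℕ) := by
    have := Finset.card_eq_sum_card_fiberwise (f := Prod.snd) (s := indexPairs N)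
      (t := Finset.univ) (by intro _ _; simp)
    rw [this]
    refine Finset.sum_congr rfl fun j _ => ?_
    rw [← Fin.card_Iio j]
    refine Finset.card_bij (fun p _ => p.1) ?_ ?_ ?_
    · rintro ⟨a, b⟩ h
      simp only [Finset.mem_filter, mem_indexPairs] at h
      simpa [← h.2] using h.1
    · rintro ⟨a, b⟩ h ⟨c, d⟩ h' e
      simp only [Finset.mem_filter, mem_indexPairs] at h h'
      simp only at e
      rw [e, h.2, h'.2]
    · intro a ha
      exact ⟨(a, j), by simpa [mem_indexPairs] using ha, rfl⟩
  rw [h, Fin.sum_univ_eq_sum_range (fun i => i) N]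
  have h2 := Finset.sum_range_id_mul_two N
  rcases N with _ | n
  · simp
  · have : ((∑ i ∈ Finset.range (n + 1), i : ℕ) : ℝ) * 2 = ((n + 1 : ℕ) : ℝ) * n := by
      exact_mod_cast h2
    rw [mul_comm, this]
    push_cast
    ring

lemma inner_rootVector (v : EuclideanSpace ℝ (Fin N)) (p : Fin N × Fin N) :
    ⟪v, rootVector p⟫ = v p.1 - v p.2 := by
  simp [rootVector, inner_sub_right, EuclideanSpace.inner_single_right]

lemma inner_gapField (f : ℝ → ℝ) (v x : EuclideanSpace ℝ (Fin N)) :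
    ⟪v, gapField f x⟫ = ∑ p ∈ indexPairs N, (v p.1 - v p.2) * f (x p.1 - x p.2) := by
  simp only [gapField, inner_sum, inner_smul_right, inner_rootVector]
  exact Finset.sum_congr rfl fun p _ => mul_comm _ _

/-- Since `1/u` is odd, the contributions of a pair to its two coordinates combine into a multiple
of one root vector. -/
lemma driftA_eq_gapField (x : EuclideanSpace ℝ (Fin N)) :
    driftA N x = gapField (fun u => 1 / u) x := by
  have key : ∀ i, (gapField (fun u => 1 / u) x) i =
      ∑ p ∈ indexPairs N,
        ((if p.1 = i then 1 / (x p.1 - x p.2) else 0) +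
          (if p.2 = i then 1 / (x p.2 - x p.1) else 0)) := by
    intro i
    simp only [gapField, rootVector, WithLp.ofLp_sum, Finset.sum_apply, PiLp.smul_apply,
      PiLp.sub_apply, PiLp.single_apply, smul_eq_mul]
    refine Finset.sum_congr rfl fun p _ => ?_
    rw [show x p.2 - x p.1 = -(x p.1 - x p.2) by ring, one_div, one_div, inv_neg]
    simp only [eq_comm (a := i)]
    split_ifs <;> ring
  ext i
  rw [key, Finset.sum_add_distrib, indexPairs, Finset.sum_filter, Finset.sum_filter,
    Fintype.sum_prod_type, Fintype.sum_prod_type_right]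
  simp only [driftA]
  have h1 : ∀ a : Fin N, (∑ b : Fin N, if a < b then
      (if a = i then 1 / (x a - x b) else 0) else 0) =
      if a = i then ∑ b : Fin N, (if i < b then 1 / (x i - x b) else 0) else 0 := by
    intro a
    split_ifs with h
    · subst h; rfl
    · simp
  have h2 : ∀ b : Fin N, (∑ a : Fin N, if a < b then
      (if b = i then 1 / (x b - x a) else 0) else 0) =
      if b = i then ∑ a : Fin N, (if a < i then 1 / (x i - x a) else 0) else 0 := by
    intro a
    split_ifs with h
    · subst h; rfl
    · simp
  simp only [h1, h2, Finset.sum_ite_eq', Finset.mem_univ, if_true]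
  rw [← Finset.sum_add_distrib, ← Finset.sum_erase (a := i) Finset.univ (by simp)]
  refine Finset.sum_congr rfl fun j hj => ?_
  rcases lt_trichotomy i j with h | h | h
  · simp [h, h.not_gt]
  · exact absurd h.symm (Finset.ne_of_mem_erase hj)
  · simp [h, h.not_gt]

lemma inner_driftA_self {x : EuclideanSpace ℝ (Fin N)} (hx : x ∈ openWeylChamberA N) :
    ⟪x, driftA N x⟫ = (N : ℝ) * ((N : ℝ) - 1) / 2 := by
  rw [driftA_eq_gapField, inner_gapField, ← two_mul_card_indexPairs,
    Finset.sum_congr rfl fun p hp =>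
      mul_one_div_cancel (mem_openWeylChamberA_iff.1 hx p hp).ne']
  simp

/-- A pair with gaps `a`, `b` contributes `-(a - b)² / (ab)`: the logarithmic potential is concave.
-/
lemma inner_sub_driftA_sub_nonpos {x y : EuclideanSpace ℝ (Fin N)}
    (hx : x ∈ openWeylChamberA N) (hy : y ∈ openWeylChamberA N) :
    ⟪x - y, driftA N x - driftA N y⟫ ≤ 0 := by
  rw [inner_sub_right, driftA_eq_gapField, driftA_eq_gapField, inner_gapField, inner_gapField,
    ← Finset.sum_sub_distrib]
  refine Finset.sum_nonpos fun p hp => ?_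
  have ha := mem_openWeylChamberA_iff.1 hx p hp
  have hb := mem_openWeylChamberA_iff.1 hy p hp
  set a := x p.1 - x p.2
  set b := y p.1 - y p.2
  have : (x - y) p.1 - (x - y) p.2 = a - b := by simp [a, b]; ring
  rw [this, show (a - b) * (1 / a) - (a - b) * (1 / b) = -((a - b) ^ 2 / (a * b)) by
    field_simp; ring]
  exact neg_nonpos.2 (by positivity)

lemma gapField_congr {f g : ℝ → ℝ} {x : EuclideanSpace ℝ (Fin N)}
    (h : ∀ p ∈ indexPairs N, f (x p.1 - x p.2) = g (x p.1 - x p.2)) :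
    gapField f x = gapField g x :=
  Finset.sum_congr rfl fun p hp => by rw [h p hp]

/-- In other words, `gapField f` is the gradient of `gapPotential F`. -/
lemma HasDerivWithinAt.gapPotential_comp {F f : ℝ → ℝ} (hF : ∀ u, HasDerivAt F (f u) u)
    {c : ℝ → EuclideanSpace ℝ (Fin N)} {c' : EuclideanSpace ℝ (Fin N)} {s : Set ℝ} {t : ℝ}
    (hc : HasDerivWithinAt c c' s t) :
    HasDerivWithinAt (fun t => gapPotential F (c t)) ⟪c', gapField f (c t)⟫ s t := by
  rw [inner_gapField]
  refine HasDerivWithinAt.fun_sum fun p _ => ?_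
  have h (i : Fin N) : HasDerivWithinAt (fun t => c t i) (c' i) s t :=
    (EuclideanSpace.proj (𝕜 := ℝ) i).hasFDerivAt.comp_hasDerivWithinAt t hc
  rw [mul_comm]
  exact (hF _).comp_hasDerivWithinAt t ((h p.1).sub (h p.2))

lemma norm_rootVector_le (p : Fin N × Fin N) : ‖rootVector p‖ ≤ 2 := by
  refine (norm_sub_le _ _).trans ?_
  simp only [PiLp.norm_single, norm_one]
  norm_num

lemma abs_gap_le (x : EuclideanSpace ℝ (Fin N)) (i j : Fin N) : |x i - x j| ≤ 2 * ‖x‖ := by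
  have h (i : Fin N) : |x i| ≤ ‖x‖ := PiLp.norm_apply_le x i
  linarith [abs_sub (x i) (x j), h i, h j]

lemma norm_gapField_le {f : ℝ → ℝ} {C : ℝ} (hf : ∀ u, |f u| ≤ C)
    (x : EuclideanSpace ℝ (Fin N)) : ‖gapField f x‖ ≤ (indexPairs N).card * (C * 2) := by
  rw [← nsmul_eq_mul]
  refine (norm_sum_le _ _).trans (Finset.sum_le_card_nsmul _ _ _ fun p _ => ?_)
  rw [norm_smul]
  exact mul_le_mul (hf _) (norm_rootVector_le p) (norm_nonneg _) ((abs_nonneg _).trans (hf 0))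

lemma norm_gapField_sub_le {f : ℝ → ℝ} {C : ℝ} (hC : 0 ≤ C)
    (hf : ∀ u v, |f u - f v| ≤ C * |u - v|) (x y : EuclideanSpace ℝ (Fin N)) :
    ‖gapField f x - gapField f y‖ ≤ (indexPairs N).card * (C * 4) * ‖x - y‖ := by
  rw [gapField, gapField, ← Finset.sum_sub_distrib, mul_assoc, ← nsmul_eq_mul]
  refine (norm_sum_le _ _).trans (Finset.sum_le_card_nsmul _ _ _ fun p _ => ?_)
  rw [← sub_smul, norm_smul, show C * 4 * ‖x - y‖ = C * (2 * ‖x - y‖) * 2 by ring]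
  refine mul_le_mul ((hf _ _).trans (mul_le_mul_of_nonneg_left ?_ hC)) (norm_rootVector_le p)
    (norm_nonneg _) (by positivity)
  refine le_of_eq_of_le (congrArg abs ?_) (abs_gap_le (x - y) p.1 p.2)
  exact sub_sub_sub_comm _ _ _ _

end GapField

/-! ### Truncated reciprocal and logarithm -/

section Truncation

/-- The function `u ↦ 1 / u`, made constant on `(-∞, δ]`. -/
noncomputable def truncInv (δ u : ℝ) : ℝ := 1 / max u δ

/-- The primitive of `truncInv δ` which equals `Real.log` on `[δ, ∞)`. -/
noncomputable def truncLog (δ u : ℝ) : ℝ := Real.log (max u δ) + min (u - δ) 0 / δ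

variable {δ : ℝ}

lemma truncInv_of_le {u : ℝ} (h : δ ≤ u) : truncInv δ u = 1 / u := by
  rw [truncInv, max_eq_left h]

lemma abs_truncInv_le (hδ : 0 < δ) (u : ℝ) : |truncInv δ u| ≤ 1 / δ := by
  have : 0 < max u δ := lt_max_of_lt_right hδ
  rw [truncInv, abs_of_pos (by positivity)]
  exact one_div_le_one_div_of_le hδ (le_max_right _ _)

lemma abs_truncInv_sub_le (hδ : 0 < δ) (u v : ℝ) :
    |truncInv δ u - truncInv δ v| ≤ 1 / δ ^ 2 * |u - v| := by
  have hu : δ ≤ max u δ := le_max_right _ _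
  have hv : δ ≤ max v δ := le_max_right _ _
  have hu' := hδ.trans_le hu
  have hv' := hδ.trans_le hv
  rw [truncInv, truncInv, div_sub_div _ _ hu'.ne' hv'.ne', abs_div,
    abs_of_pos (mul_pos hu' hv'), div_eq_mul_one_div, mul_comm]
  refine mul_le_mul ?_ ?_ (abs_nonneg _) (by positivity)
  · exact one_div_le_one_div_of_le (by positivity) (by nlinarith)
  · rw [one_mul, mul_one, abs_sub_comm]
    exact abs_max_sub_max_le_abs u v δ

lemma mul_truncInv_le_one (hδ : 0 < δ) (u : ℝ) : u * truncInv δ u ≤ 1 := by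
  rw [truncInv, mul_one_div, div_le_one (lt_max_of_lt_right hδ)]
  exact le_max_left _ _

lemma truncLog_le (hδ : 0 < δ) (u : ℝ) : truncLog δ u ≤ Real.log (max u δ) :=
  add_le_of_nonpos_right (div_nonpos_of_nonpos_of_nonneg (min_le_right _ _) hδ.le)

/-- Below `δ` the truncation follows the tangent of `log` at `δ`, which lies above the graph. This
yields lower bounds for the truncated potential that do not depend on `δ`. -/
lemma log_le_truncLog (hδ : 0 < δ) {u : ℝ} (hu : 0 < u) : Real.log u ≤ truncLog δ u := by
  rcases le_total δ u with h | h
  · simp [truncLog, max_eq_left h, min_eq_right (sub_nonneg.2 h)]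
  · rw [truncLog, max_eq_right h, min_eq_left (sub_nonpos.2 h), sub_div, div_self hδ.ne']
    have := Real.log_le_sub_one_of_pos (div_pos hu hδ)
    rw [Real.log_div hu.ne' hδ.ne'] at this
    linarith

lemma hasDerivAt_truncLog (hδ : 0 < δ) (u : ℝ) : HasDerivAt (truncLog δ) (truncInv δ u) u := by
  have hl : ∀ v ∈ Set.Iic δ, truncLog δ v = Real.log δ + (v - δ) / δ := fun v hv => by
    rw [truncLog, max_eq_right hv, min_eq_left (sub_nonpos.2 hv)]
  have hr : ∀ v ∈ Set.Ici δ, truncLog δ v = Real.log v := fun v hv => by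
    rw [truncLog, max_eq_left hv, min_eq_right (sub_nonneg.2 hv), zero_div, add_zero]
  have dl (v : ℝ) : HasDerivAt (fun v => Real.log δ + (v - δ) / δ) (1 / δ) v :=
    (((hasDerivAt_id v).sub_const δ).div_const δ).const_add _
  have dr {v : ℝ} (hv : δ ≤ v) : HasDerivAt Real.log (1 / v) v := by
    rw [one_div]; exact Real.hasDerivAt_log (hδ.trans_le hv).ne'
  rcases lt_trichotomy u δ with h | rfl | h
  · rw [truncInv, max_eq_right h.le]
    exact (dl u).congr_of_eventuallyEq
      (Filter.mem_of_superset (Iio_mem_nhds h) fun v hv => hl v (Set.Iio_subset_Iic_self hv))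
  · rw [truncInv, max_self, ← hasDerivWithinAt_univ, ← Set.Iic_union_Ici (a := u)]
    exact ((dl u).hasDerivWithinAt.congr hl (hl u Set.self_mem_Iic)).union
      ((dr le_rfl).hasDerivWithinAt.congr hr (hr u Set.self_mem_Ici))
  · rw [truncInv_of_le h.le]
    exact (dr h.le).congr_of_eventuallyEq
      (Filter.mem_of_superset (Ioi_mem_nhds h) fun v hv => hr v (Set.Ioi_subset_Ici_self hv))

end Truncation

/-! ### Hermite's equation and Stieltjes' characterization of the zeros -/

section HermiteODE

open Polynomial

lemma derivative_hermite_succ (n : ℕ) :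
    derivative (hermite (n + 1)) = ((n : ℤ[X]) + 1) * hermite n := by
  induction n with
  | zero => simp
  | succ n ih =>
    rw [hermite_succ (n + 1), derivative_sub, derivative_mul, ih, derivative_mul, derivative_X]
    have : derivative ((n : ℤ[X]) + 1) = 0 := by simp
    rw [this]
    have h := hermite_succ n
    push_cast
    linear_combination (-(n : ℤ[X]) - 1) * h

/-- Hermite's differential equation. -/
lemma hermite_differential_equation (n : ℕ) :
    derivative (derivative (hermite n)) - X * derivative (hermite n) + (n : ℤ[X]) * hermite n
      = 0 := by
  have h := derivative_hermite_succ n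
  rw [hermite_succ, derivative_sub, derivative_mul, derivative_X] at h
  linear_combination -h

/-- A polynomial of degree less than `n` which solves Hermite's differential equation of
order `n` vanishes. -/
lemma eq_zero_of_hermite_equation {n : ℕ} {p : ℝ[X]} (hp : p.degree < n)
    (h : derivative (derivative p) - X * derivative p + (n : ℝ[X]) * p = 0) : p = 0 := by
  by_contra hne
  have hlt : p.natDegree < n := (natDegree_lt_iff_degree_lt hne).2 hp
  set m := p.natDegree with hm
  have hc := congrArg (fun q => coeff q m) h
  have h2 : coeff (derivative (derivative p)) m = 0 := by
    rw [coeff_derivative, coeff_derivative, coeff_eq_zero_of_natDegree_lt (by omega)]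
    simp
  have h1 : coeff (X * derivative p) m = m * p.coeff m := by
    rcases m with _ | k
    · simp
    · rw [coeff_X_mul, coeff_derivative]; push_cast; ring
  -- In degree `m` the equation reads `(n - m) * leadingCoeff = 0`, impossible for `m < n`.
  simp only [coeff_add, coeff_sub, h1, h2, coeff_zero] at hc
  rw [← C_eq_natCast, coeff_C_mul] at hc
  have h3 : ((n : ℝ) - m) * p.coeff m = 0 := by linear_combination hc
  have h4 : (n : ℝ) - m ≠ 0 := sub_ne_zero.2 (by exact_mod_cast hlt.ne')
  exact hne (leadingCoeff_eq_zero.1 ((mul_eq_zero.1 h3).resolve_left h4))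

lemma eval_derivative_prod_X_sub_C {ι : Type*} [DecidableEq ι] (s : Finset ι) (w : ι → ℝ)
    {r : ℝ} (hr : ∀ j ∈ s, r - w j ≠ 0) :
    (derivative (∏ j ∈ s, (X - C (w j)))).eval r =
      (∏ j ∈ s, (X - C (w j))).eval r * ∑ j ∈ s, 1 / (r - w j) := by
  rw [derivative_prod_finset, eval_finsetSum, Finset.mul_sum]
  refine Finset.sum_congr rfl fun j hj => ?_
  rw [← Finset.mul_prod_erase s _ hj]
  have := hr j hj
  simp only [derivative_sub, derivative_X, derivative_C, sub_zero, mul_one, eval_mul, eval_sub,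
    eval_X, eval_C]
  field_simp

/-- Stieltjes: a configuration in equilibrium consists of the zeros of a Hermite polynomial. -/
lemma hermite_map_eq_prod {n : ℕ} {w : Fin n → ℝ} (hw : Function.Injective w)
    (h : ∀ i, 2 * ∑ j ∈ Finset.univ.erase i, 1 / (w i - w j) = w i) :
    (hermite n).map (Int.castRingHom ℝ) = ∏ i, (X - C (w i)) := by
  set p : ℝ[X] := ∏ i, (X - C (w i)) with hp
  have hmonic : p.Monic := monic_prod_of_monic _ _ fun i _ => monic_X_sub_C _
  have hdeg : p.natDegree = n := by
    rw [hp, natDegree_prod_of_monic _ _ fun i _ => monic_X_sub_C _]; simp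
  -- The left side has degree below `n`, since the terms of degree `n` cancel, and it vanishes at
  -- the `n` distinct points `w i`. There `p = (X - w i) q` gives `p' = q` and `p'' = 2 q'`, so
  -- vanishing is the equilibrium condition times `q (w i)`.
  have hode : derivative (derivative p) - X * derivative p + (n : ℝ[X]) * p = 0 := by
    rcases Nat.eq_zero_or_pos n with rfl | hn
    · simp [hp]
    have hcoeff : ∀ m, n ≤ m →
        (derivative (derivative p) - X * derivative p + (n : ℝ[X]) * p).coeff m = 0 := by
      intro m hnm
      have h2 : coeff (derivative (derivative p)) m = 0 := by
        rw [coeff_derivative, coeff_derivative, coeff_eq_zero_of_natDegree_lt (by omega)]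
        simp
      obtain ⟨k, rfl⟩ : ∃ k, m = k + 1 := ⟨m - 1, by omega⟩
      rw [coeff_add, coeff_sub, h2, ← C_eq_natCast, coeff_C_mul, coeff_X_mul, coeff_derivative]
      rcases hnm.eq_or_lt with e | e
      · rw [e]; push_cast; ring
      · rw [coeff_eq_zero_of_natDegree_lt (by omega)]; simp
    refine eq_zero_of_degree_lt_of_eval_index_eq_zero (s := Finset.univ) (v := w)
      hw.injOn ?_ ?_
    · rw [Finset.card_univ, Fintype.card_fin, degree_lt_iff_coeff_zero]
      exact hcoeff
    · intro i _
      set q : ℝ[X] := ∏ j ∈ Finset.univ.erase i, (X - C (w j)) with hq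
      have hpq : p = (X - C (w i)) * q := (Finset.mul_prod_erase _ _ (Finset.mem_univ i)).symm
      have h1 := eval_derivative_prod_X_sub_C (Finset.univ.erase i) w (r := w i)
        fun j hj => sub_ne_zero.2 (hw.ne (Finset.ne_of_mem_erase hj).symm)
      rw [← hq] at h1
      rw [hpq]
      simp only [derivative_mul, derivative_sub, derivative_X, derivative_C, derivative_add,
        eval_add, eval_sub, eval_mul, eval_X, eval_C, h1, sub_self, sub_zero, one_mul, zero_mul,
        mul_zero, add_zero]
      linear_combination (q.eval (w i)) * h i
  have hhermite : ((hermite n).map (Int.castRingHom ℝ)).Monic := (hermite_monic n).map _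
  have hhdeg : ((hermite n).map (Int.castRingHom ℝ)).natDegree = n := by
    rw [(hermite_monic n).natDegree_map, natDegree_hermite]
  have hhode := congrArg (Polynomial.map (Int.castRingHom ℝ)) (hermite_differential_equation n)
  simp only [Polynomial.map_add, Polynomial.map_sub, Polynomial.map_mul, ← derivative_map,
    Polynomial.map_X, Polynomial.map_natCast, Polynomial.map_zero] at hhode
  -- Both polynomials are monic of degree `n`, so their difference is a solution of lower degree.
  refine sub_eq_zero.1 (eq_zero_of_hermite_equation (n := n) ?_ ?_)
  · have := degree_sub_lt_left (p := (hermite n).map (Int.castRingHom ℝ)) (q := p) (by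
      rw [degree_eq_natDegree hhermite.ne_zero, degree_eq_natDegree hmonic.ne_zero, hhdeg, hdeg])
      hhermite.ne_zero (by rw [hhermite.leadingCoeff, hmonic.leadingCoeff])
    rwa [degree_eq_natDegree hhermite.ne_zero, hhdeg] at this
  · simp only [derivative_sub]
    linear_combination hhode - hode

lemma isOrderedHermiteZeros_of_driftA_eq {N : ℕ} {z : EuclideanSpace ℝ (Fin N)}
    (hz : z ∈ openWeylChamberA N) (h : driftA N z = z) : IsOrderedHermiteZeros N z := by
  refine ⟨hz, fun r => ?_⟩
  have h2 : Real.sqrt 2 ≠ 0 := by positivity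
  have hw : Function.Injective fun i => Real.sqrt 2 * z i := fun i j hij =>
    hz.injective (mul_left_cancel₀ h2 hij)
  have heq (i : Fin N) : 2 * ∑ j ∈ Finset.univ.erase i,
      1 / (Real.sqrt 2 * z i - Real.sqrt 2 * z j) = Real.sqrt 2 * z i := by
    have hi : ∑ j ∈ Finset.univ.erase i, 1 / (z i - z j) = z i :=
      congrArg (fun v : EuclideanSpace ℝ (Fin N) => v i) h
    simp only [← mul_sub, one_div, mul_inv, ← Finset.mul_sum] at hi ⊢
    rw [hi]
    field_simp
    rw [Real.sq_sqrt (by norm_num)]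
  rw [hermiteH, hermite_map_eq_prod hw heq, IsRoot.def, eval_mul, eval_C, mul_eq_zero,
    or_iff_right (pow_ne_zero _ h2), eval_comp, eval_prod, Finset.prod_eq_zero_iff]
  refine exists_congr fun i => ?_
  simp [sub_eq_zero, h2, eq_comm (a := r)]

end HermiteODE

/-! ### A fixed point of the drift by energy minimization -/

section Equilibrium

variable {N : ℕ}

lemma inner_gapField_truncInv_self_le {δ : ℝ} (hδ : 0 < δ) (x : EuclideanSpace ℝ (Fin N)) :
    ⟪x, gapField (truncInv δ) x⟫ ≤ (indexPairs N).card := by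
  rw [inner_gapField]
  simpa using Finset.sum_le_card_nsmul _ _ 1 fun p (_ : p ∈ indexPairs N) =>
    mul_truncInv_le_one hδ (x p.1 - x p.2)

/-- Bounds on the norm and on the potential keep the gaps in the region where the truncated
interaction is the original one, provided that the truncation level is small enough. -/
lemma exists_truncation_level (N : ℕ) (R l : ℝ) :
    ∃ δ : ℝ, 0 < δ ∧ δ ≤ 1 ∧ ∀ x : EuclideanSpace ℝ (Fin N), ‖x‖ ≤ R →
      l ≤ gapPotential (truncLog δ) x → ∀ p ∈ indexPairs N, δ < x p.1 - x p.2 := by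
  set B : ℝ := 2 * |R| + 1
  set m : ℝ := ((indexPairs N).card : ℝ)
  have hB : 1 ≤ B := by have := abs_nonneg R; simp only [B]; linarith
  -- Each pair contributes at most `log B` to the potential. A gap at most `δ` would contribute at
  -- most `log δ`, pushing the total to `l - 1` or less.
  set δ : ℝ := Real.exp (min 0 (l - m * Real.log B - 1))
  have hδ : 0 < δ := Real.exp_pos _
  have hδ1 : δ ≤ 1 := Real.exp_le_one_iff.2 (min_le_left _ _)
  have hlog : Real.log δ ≤ l - m * Real.log B - 1 := by
    rw [Real.log_exp]; exact min_le_right _ _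
  refine ⟨δ, hδ, hδ1, fun x hx hl p hp => ?_⟩
  by_contra! hle
  have hF : ∀ q ∈ indexPairs N, truncLog δ (x q.1 - x q.2) ≤ Real.log B := fun q _ => by
    refine (truncLog_le hδ _).trans
      (Real.log_le_log (lt_max_of_lt_right hδ) (max_le ?_ (hδ1.trans hB)))
    have h1 := (le_abs_self _).trans (abs_gap_le x q.1 q.2)
    have h2 := hx.trans (le_abs_self R)
    simp only [B]
    linarith
  have hFp : truncLog δ (x p.1 - x p.2) ≤ Real.log δ := by
    simpa [max_eq_right hle] using truncLog_le hδ (x p.1 - x p.2)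
  have hrest : ∑ q ∈ (indexPairs N).erase p, truncLog δ (x q.1 - x q.2) ≤ m * Real.log B := by
    refine (Finset.sum_le_card_nsmul _ _ _
      fun q hq => hF q (Finset.mem_of_mem_erase hq)).trans ?_
    rw [nsmul_eq_mul]
    refine mul_le_mul_of_nonneg_right ?_ (Real.log_nonneg hB)
    exact Nat.cast_le.2 (Finset.card_le_card (Finset.erase_subset p (indexPairs N)))
  rw [gapPotential, ← Finset.add_sum_erase _ _ hp] at hl
  linarith

lemma gapField_truncInv_eq_driftA {δ : ℝ} {x : EuclideanSpace ℝ (Fin N)}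
    (h : ∀ p ∈ indexPairs N, δ < x p.1 - x p.2) : gapField (truncInv δ) x = driftA N x := by
  rw [driftA_eq_gapField]
  exact gapField_congr fun p hp => truncInv_of_le (h p hp).le

lemma continuous_gapPotential {F : ℝ → ℝ} (hF : Continuous F) :
    Continuous (gapPotential (N := N) F) := by
  unfold gapPotential
  fun_prop

lemma gapPotential_truncLog_le {δ : ℝ} (hδ : 0 < δ) (hδ1 : δ ≤ 1)
    (x : EuclideanSpace ℝ (Fin N)) :
    gapPotential (truncLog δ) x ≤ (indexPairs N).card * (2 * ‖x‖) := by
  rw [← nsmul_eq_mul]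
  refine Finset.sum_le_card_nsmul _ _ _ fun p _ => ?_
  refine (truncLog_le hδ _).trans ((Real.log_le_sub_one_of_pos (lt_max_of_lt_right hδ)).trans ?_)
  refine le_trans ?_ (abs_gap_le x p.1 p.2)
  rw [sub_le_iff_le_add]
  exact max_le (by linarith [le_abs_self (x p.1 - x p.2)])
    (by linarith [abs_nonneg (x p.1 - x p.2)])

/-- The truncated confined energy attains its minimum. -/
lemma exists_min_truncated_energy {δ : ℝ} (hδ : 0 < δ) (hδ1 : δ ≤ 1) :
    ∃ z : EuclideanSpace ℝ (Fin N), ∀ y : EuclideanSpace ℝ (Fin N),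
      ‖z‖ ^ 2 / 2 - gapPotential (truncLog δ) z ≤ ‖y‖ ^ 2 / 2 - gapPotential (truncLog δ) y := by
  have hF : Continuous (truncLog δ) :=
    continuous_iff_continuousAt.2 fun u => (hasDerivAt_truncLog hδ u).continuousAt
  have hP := continuous_gapPotential (N := N) hF
  refine Continuous.exists_forall_le (by fun_prop) ?_
  -- With this `c`, completing the square bounds the energy below by `‖x‖ - c²/2`.
  set c : ℝ := 2 * (indexPairs N).card + 1 with hc
  refine tendsto_atTop_mono (fun x => ?_)
    (tendsto_atTop_add_const_right _ (-(c ^ 2 / 2)) (tendsto_norm_cocompact_atTop (E := _)))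
  nlinarith [gapPotential_truncLog_le hδ hδ1 x, sq_nonneg (‖x‖ - c)]

/-- A minimizer of the truncated confined energy is an equilibrium. -/
lemma gapField_eq_self_of_min {δ : ℝ} (hδ : 0 < δ) {z : EuclideanSpace ℝ (Fin N)}
    (hz : ∀ y : EuclideanSpace ℝ (Fin N),
      ‖z‖ ^ 2 / 2 - gapPotential (truncLog δ) z ≤ ‖y‖ ^ 2 / 2 - gapPotential (truncLog δ) y) :
    gapField (truncInv δ) z = z := by
  -- This is the gradient of the energy at `z`; the derivative along it is `‖v‖²`.
  set v := z - gapField (truncInv δ) z with hv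
  have hline : HasDerivAt (fun s : ℝ => z + s • v) v 0 := by
    simpa using ((hasDerivAt_id (0 : ℝ)).smul_const v).const_add z
  have h1 := hline.norm_sq.div_const 2
  have h2 := hline.hasDerivWithinAt (s := Set.univ).gapPotential_comp (hasDerivAt_truncLog hδ)
  rw [hasDerivWithinAt_univ] at h2
  have h3 := h1.sub h2
  have hmin : IsLocalMin ((fun s : ℝ => ‖z + s • v‖ ^ 2 / 2) -
      fun s : ℝ => gapPotential (truncLog δ) (z + s • v)) 0 :=
    Eventually.of_forall fun s => by simpa using hz (z + s • v)
  have h0 := hmin.hasDerivAt_eq_zero h3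
  simp only [zero_smul, add_zero] at h0
  have : ⟪v, v⟫ = 0 := by
    nth_rewrite 2 [hv]
    rw [inner_sub_right, real_inner_comm z v]
    linarith
  exact (sub_eq_zero.1 (inner_self_eq_zero.1 this)).symm

/-- The drift has a fixed point in the Weyl chamber. -/
lemma exists_driftA_eq_self (N : ℕ) :
    ∃ z : EuclideanSpace ℝ (Fin N), z ∈ openWeylChamberA N ∧ driftA N z = z := by
  -- A competitor with all gaps at least 1: its truncated potential is nonnegative, so minimality
  -- bounds that of `z` below by `-‖b‖²/2`, whatever `δ` is.
  set b : EuclideanSpace ℝ (Fin N) := WithLp.toLp 2 fun i => -((i : ℕ) : ℝ) with hb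
  obtain ⟨δ, hδ, hδ1, h⟩ :=
    exists_truncation_level N (Real.sqrt (indexPairs N).card) (-(‖b‖ ^ 2 / 2))
  obtain ⟨z, hz⟩ := exists_min_truncated_energy (N := N) hδ hδ1
  have heq := gapField_eq_self_of_min hδ hz
  have hnorm : ‖z‖ ≤ Real.sqrt (indexPairs N).card := by
    refine Real.le_sqrt_of_sq_le ?_
    have := inner_gapField_truncInv_self_le hδ z
    rwa [heq, real_inner_self_eq_norm_sq] at this
  have hbpot : 0 ≤ gapPotential (truncLog δ) b := Finset.sum_nonneg fun p hp => by
    have h1 : (1 : ℝ) ≤ b p.1 - b p.2 := by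
      have : ((p.1 : ℕ) : ℝ) + 1 ≤ ((p.2 : ℕ) : ℝ) := by
        exact_mod_cast (mem_indexPairs.1 hp : (p.1 : ℕ) < p.2)
      simp only [hb]
      linarith
    exact (Real.log_nonneg h1).trans (log_le_truncLog hδ (by linarith))
  have hgap := h z hnorm (by nlinarith [hz b, sq_nonneg ‖z‖])
  exact ⟨z, mem_openWeylChamberA_iff.2 fun p hp => hδ.trans (hgap p hp),
    (gapField_truncInv_eq_driftA hgap).symm.trans heq⟩

end Equilibrium

/-! ### Existence, uniqueness and asymptotics of the flow -/

section Flow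

variable {N : ℕ}

lemma HasDerivWithinAt.of_Icc_interior {E : Type*} [NormedAddCommGroup E] [NormedSpace ℝ E]
    {T t : ℝ} {f : ℝ → E} {f' : E} (h : HasDerivWithinAt f f' (Set.Icc 0 T) t) :
    HasDerivWithinAt f f' (interior (Set.Icc 0 T)) t :=
  h.mono interior_subset

/-- The truncated system has solutions on every interval `[0, T]`. -/
lemma exists_truncated_solution {δ T : ℝ} (hδ : 0 < δ) (hT : 0 ≤ T)
    (x₀ : EuclideanSpace ℝ (Fin N)) :
    ∃ x : ℝ → EuclideanSpace ℝ (Fin N), x 0 = x₀ ∧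
      ∀ t ∈ Set.Icc 0 T, HasDerivWithinAt x (gapField (truncInv δ) (x t)) (Set.Icc 0 T) t := by
  set L : NNReal := Real.toNNReal ((indexPairs N).card * (1 / δ * 2)) with hL
  set K : NNReal := Real.toNNReal ((indexPairs N).card * (1 / δ ^ 2 * 4)) with hK
  -- The field is bounded by `L` everywhere, so a ball of radius `L * T` suffices up to time `T`.
  have hpl : IsPicardLindelof (fun _ : ℝ => gapField (N := N) (truncInv δ))
      (tmin := 0) (tmax := T) ⟨0, Set.left_mem_Icc.2 hT⟩ x₀ (L * T.toNNReal) 0 L K := by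
    refine ⟨fun t _ => ?_, fun x _ => continuousOn_const, fun t _ x _ => ?_, ?_⟩
    · refine (LipschitzWith.of_dist_le_mul fun x y => ?_).lipschitzOnWith
      rw [dist_eq_norm, dist_eq_norm, hK, Real.coe_toNNReal _ (by positivity)]
      exact norm_gapField_sub_le (by positivity) (abs_truncInv_sub_le hδ) x y
    · rw [hL, Real.coe_toNNReal _ (by positivity)]
      exact norm_gapField_le (abs_truncInv_le hδ) x
    · simp [hT]
  exact hpl.exists_eq_forall_mem_Icc_hasDerivWithinAt₀

/-- The drift has solutions in the Weyl chamber on every interval `[0, T]`. -/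
lemma exists_solution_Icc {x₀ : EuclideanSpace ℝ (Fin N)} (hx₀ : x₀ ∈ openWeylChamberA N)
    {T : ℝ} (hT : 0 ≤ T) :
    ∃ x : ℝ → EuclideanSpace ℝ (Fin N), x 0 = x₀ ∧ ∀ t ∈ Set.Icc 0 T,
      x t ∈ openWeylChamberA N ∧ HasDerivWithinAt x (driftA N (x t)) (Set.Icc 0 T) t := by
  set m : ℝ := ((indexPairs N).card : ℝ) with hm
  set R : ℝ := Real.sqrt (2 * m * T + ‖x₀‖ ^ 2) with hR
  obtain ⟨δ, hδ, -, hgap⟩ := exists_truncation_level N R (gapPotential Real.log x₀)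
  obtain ⟨x, hx0, hx⟩ := exists_truncated_solution (N := N) hδ hT x₀
  have hcont : ContinuousOn x (Set.Icc 0 T) := fun t ht => (hx t ht).continuousWithinAt
  have hmem : (0 : ℝ) ∈ Set.Icc 0 T := Set.left_mem_Icc.2 hT
  have hnorm : ∀ t ∈ Set.Icc 0 T, ‖x t‖ ≤ R := by
    intro t ht
    have hd (s) (hs : s ∈ Set.Icc 0 T) := (hx s hs).norm_sq.sub
      ((hasDerivWithinAt_id s (Set.Icc 0 T)).const_mul (2 * m))
    have hanti := antitoneOn_of_hasDerivWithinAt_nonpos (convex_Icc 0 T)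
      (fun s hs => (hd s hs).continuousWithinAt)
      (fun s hs => (hd s (interior_subset hs)).of_Icc_interior) (fun s _ => by
        have := inner_gapField_truncInv_self_le hδ (x s)
        linarith) hmem ht ht.1
    simp only [Pi.sub_apply, hx0, id, mul_zero, sub_zero] at hanti
    refine Real.le_sqrt_of_sq_le ?_
    have : 2 * m * t ≤ 2 * m * T := mul_le_mul_of_nonneg_left ht.2 (by positivity)
    linarith
  -- Along its own gradient flow the potential has derivative `‖gapField (truncInv δ) (x s)‖² ≥ 0`.
  have hpot : ∀ t ∈ Set.Icc 0 T, gapPotential Real.log x₀ ≤ gapPotential (truncLog δ) (x t) := by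
    intro t ht
    have hd (s) (hs : s ∈ Set.Icc 0 T) := (hx s hs).gapPotential_comp (hasDerivAt_truncLog hδ)
    have hmono := monotoneOn_of_hasDerivWithinAt_nonneg (convex_Icc 0 T)
      (fun s hs => (hd s hs).continuousWithinAt)
      (fun s hs => (hd s (interior_subset hs)).of_Icc_interior)
      (fun s _ => real_inner_self_nonneg) hmem ht ht.1
    simp only [hx0] at hmono
    refine le_trans (Finset.sum_le_sum fun p hp => ?_) hmono
    exact log_le_truncLog hδ (mem_openWeylChamberA_iff.1 hx₀ p hp)
  refine ⟨x, hx0, fun t ht => ?_⟩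
  have hg := hgap (x t) (hnorm t ht) (hpot t ht)
  refine ⟨mem_openWeylChamberA_iff.2 fun p hp => hδ.trans (hg p hp), ?_⟩
  rw [← gapField_truncInv_eq_driftA hg]
  exact hx t ht

/-- The distance of two solutions does not increase. -/
lemma norm_sub_le_of_solutions {T : ℝ} {x y : ℝ → EuclideanSpace ℝ (Fin N)}
    (hx : ∀ t ∈ Set.Icc 0 T,
      x t ∈ openWeylChamberA N ∧ HasDerivWithinAt x (driftA N (x t)) (Set.Icc 0 T) t)
    (hy : ∀ t ∈ Set.Icc 0 T,
      y t ∈ openWeylChamberA N ∧ HasDerivWithinAt y (driftA N (y t)) (Set.Icc 0 T) t)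
    {t : ℝ} (ht : t ∈ Set.Icc 0 T) : ‖x t - y t‖ ≤ ‖x 0 - y 0‖ := by
  have hd (s) (hs : s ∈ Set.Icc 0 T) := ((hx s hs).2.sub (hy s hs).2).norm_sq
  have hanti := antitoneOn_of_hasDerivWithinAt_nonpos (convex_Icc 0 T)
    (fun s hs => (hd s hs).continuousWithinAt)
    (fun s hs => (hd s (interior_subset hs)).of_Icc_interior) (fun s hs => by
      have := inner_sub_driftA_sub_nonpos (hx s (interior_subset hs)).1
        (hy s (interior_subset hs)).1
      simp only [Pi.sub_apply]
      linarith) (Set.left_mem_Icc.2 (ht.1.trans ht.2)) ht ht.1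
  exact le_of_sq_le_sq hanti (norm_nonneg _)

lemma IsSolutionA.restrict {x₀ : EuclideanSpace ℝ (Fin N)} {x : ℝ → EuclideanSpace ℝ (Fin N)}
    (h : IsSolutionA N x₀ x) (T : ℝ) : ∀ t ∈ Set.Icc 0 T,
      x t ∈ openWeylChamberA N ∧ HasDerivWithinAt x (driftA N (x t)) (Set.Icc 0 T) t :=
  fun t ht => ⟨h.mem t ht.1, (h.ode t ht.1).mono Set.Icc_subset_Ici_self⟩

lemma IsSolutionA.norm_sub_le {x₀ y₀ : EuclideanSpace ℝ (Fin N)}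
    {x y : ℝ → EuclideanSpace ℝ (Fin N)} (hx : IsSolutionA N x₀ x) (hy : IsSolutionA N y₀ y)
    {t : ℝ} (ht : 0 ≤ t) : ‖x t - y t‖ ≤ ‖x₀ - y₀‖ := by
  have := norm_sub_le_of_solutions (hx.restrict t) (hy.restrict t) (Set.right_mem_Icc.2 ht)
  rwa [hx.init, hy.init] at this

lemma exists_isSolutionA {x₀ : EuclideanSpace ℝ (Fin N)} (hx₀ : x₀ ∈ openWeylChamberA N) :
    ∃ x, IsSolutionA N x₀ x := by
  choose u hu0 hu using fun n : ℕ => exists_solution_Icc hx₀ (T := n) n.cast_nonneg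
  have hagree {m n : ℕ} {t : ℝ} (ht : 0 ≤ t) (hm : t ≤ m) (hn : t ≤ n) : u m t = u n t := by
    have hres (k : ℕ) (hk : t ≤ k) : ∀ s ∈ Set.Icc 0 t, u k s ∈ openWeylChamberA N ∧
        HasDerivWithinAt (u k) (driftA N (u k s)) (Set.Icc 0 t) s := fun s hs =>
      ⟨(hu k s ⟨hs.1, hs.2.trans hk⟩).1,
        (hu k s ⟨hs.1, hs.2.trans hk⟩).2.mono (Set.Icc_subset_Icc_right hk)⟩
    have := norm_sub_le_of_solutions (hres m hm) (hres n hn) (Set.right_mem_Icc.2 ht)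
    rw [hu0, hu0, sub_self, norm_zero] at this
    exact sub_eq_zero.1 (norm_le_zero_iff.1 this)
  have hext {n : ℕ} {t : ℝ} (ht : 0 ≤ t) (hn : t ≤ n) : u ⌈t⌉₊ t = u n t :=
    hagree ht (Nat.le_ceil t) hn
  refine ⟨fun t => u ⌈t⌉₊ t, by simp [hu0], fun t ht => (hu _ t ⟨ht, Nat.le_ceil t⟩).1,
    fun t ht => ?_⟩
  -- Strictness makes `Iic n` a neighbourhood of `t`, on which the glued function equals the single
  -- solution `u n` for nonnegative times.
  obtain ⟨n, hn⟩ := exists_nat_gt t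
  simp only [hext ht hn.le]
  have hd := (hu n t ⟨ht, hn.le⟩).2
  have hloc : HasDerivWithinAt (u n) (driftA N (u n t)) (Set.Ici 0) t := by
    refine hd.mono_of_mem_nhdsWithin ?_
    rw [← Set.Ici_inter_Iic]
    exact Filter.inter_mem self_mem_nhdsWithin (mem_nhdsWithin_of_mem_nhds (Iic_mem_nhds hn))
  refine hloc.congr_of_eventuallyEq ?_ (hext ht hn.le)
  filter_upwards [self_mem_nhdsWithin, mem_nhdsWithin_of_mem_nhds (Iic_mem_nhds hn)]
    with s hs hsn using hext hs hsn

lemma IsSolutionA.norm_sq_eq {x₀ : EuclideanSpace ℝ (Fin N)}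
    {x : ℝ → EuclideanSpace ℝ (Fin N)} (h : IsSolutionA N x₀ x) {t : ℝ} (ht : 0 ≤ t) :
    ‖x t‖ ^ 2 = (N : ℝ) * ((N : ℝ) - 1) * t + ‖x₀‖ ^ 2 := by
  have hd (s) (hs : s ∈ Set.Icc 0 t) := (h.restrict t s hs).2.norm_sq.sub
    ((hasDerivWithinAt_id s (Set.Icc 0 t)).const_mul ((N : ℝ) * ((N : ℝ) - 1)))
  have hz (s) (hs : s ∈ Set.Icc 0 t) : 2 * ⟪x s, driftA N (x s)⟫ -
      (N : ℝ) * ((N : ℝ) - 1) * 1 = 0 := by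
    rw [inner_driftA_self (h.mem s hs.1)]; ring
  have hconst := constant_of_has_deriv_right_zero
    (fun s hs => (hd s hs).continuousWithinAt) (fun s hs => by
      have := hd s (Set.Ico_subset_Icc_self hs)
      rw [hz s (Set.Ico_subset_Icc_self hs)] at this
      exact this.mono_of_mem_nhdsWithin (Icc_mem_nhdsGE_of_mem hs)) t (Set.right_mem_Icc.2 ht)
  simp only [Pi.sub_apply, h.init, id, mul_zero, sub_zero] at hconst
  linarith

lemma driftA_smul (r : ℝ) (x : EuclideanSpace ℝ (Fin N)) :
    driftA N (r • x) = r⁻¹ • driftA N x := by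
  ext i
  simp only [driftA, PiLp.smul_apply, smul_eq_mul, Finset.mul_sum, ← mul_sub, one_div, mul_inv]

/-- A fixed point of the drift generates a self-similar solution. -/
lemma isSolutionA_sqrt_smul {z : EuclideanSpace ℝ (Fin N)} (hz : z ∈ openWeylChamberA N)
    (hfix : driftA N z = z) {c : ℝ} (hc : 0 < c) :
    IsSolutionA N (Real.sqrt c • z) fun t => Real.sqrt (2 * t + c) • z := by
  refine ⟨by simp, fun t ht i j hij => ?_, fun t ht => ?_⟩
  · exact mul_lt_mul_of_pos_left (hz hij) (Real.sqrt_pos.2 (by positivity))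
  · have hpos : 0 < 2 * t + c := by positivity
    rw [driftA_smul, hfix]
    have h := (((hasDerivAt_id t).const_mul 2).add_const c).sqrt hpos.ne'
    have h' := (h.smul_const z).hasDerivWithinAt (s := Set.Ici 0)
    refine h'.congr_deriv ?_
    simp only [id]
    congr 1
    field_simp

lemma IsSolutionA.exists_direction (hN : 2 ≤ N) {z x₀ : EuclideanSpace ℝ (Fin N)}
    (hz : z ∈ openWeylChamberA N) (hfix : driftA N z = z) (hx₀ : x₀ ∈ openWeylChamberA N)
    {x : ℝ → EuclideanSpace ℝ (Fin N)} (hx : IsSolutionA N x₀ x) :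
    ∃ φ : ℝ → EuclideanSpace ℝ (Fin N),
      (∀ t : ℝ, 0 ≤ t →
        x t = Real.sqrt ((N : ℝ) * ((N : ℝ) - 1) * t + ‖x₀‖ ^ 2) • φ t ∧ ‖φ t‖ = 1) ∧
      Tendsto φ atTop (𝓝 (Real.sqrt (2 / ((N : ℝ) * ((N : ℝ) - 1))) • z)) := by
  have hN' : (2 : ℝ) ≤ N := by exact_mod_cast hN
  set a : ℝ := (N : ℝ) * ((N : ℝ) - 1) with ha
  have ha0 : 0 < a := mul_pos (by linarith) (by linarith)
  have hx₀ne : x₀ ≠ 0 := by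
    rintro rfl
    have := hx₀ (a := ⟨0, by omega⟩) (b := ⟨1, by omega⟩) (Fin.mk_lt_mk.2 one_pos)
    simp at this
  have hn0 : 0 < ‖x₀‖ ^ 2 := by positivity
  set s : ℝ → ℝ := fun t => Real.sqrt (a * t + ‖x₀‖ ^ 2) with hs
  have hspos {t : ℝ} (ht : 0 ≤ t) : 0 < s t := Real.sqrt_pos.2 (by positivity)
  have hstend : Tendsto s atTop atTop := by
    refine Real.tendsto_sqrt_atTop.comp (tendsto_atTop_add_const_right _ _ ?_)
    exact tendsto_id.const_mul_atTop ha0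
  refine ⟨fun t => (s t)⁻¹ • x t, fun t ht => ⟨(smul_inv_smul₀ (hspos ht).ne' _).symm, ?_⟩, ?_⟩
  · have hnorm : ‖x t‖ = s t := by
      simp only [hs]
      rw [← hx.norm_sq_eq ht, Real.sqrt_sq (norm_nonneg _)]
    rw [norm_smul, norm_inv, Real.norm_of_nonneg (hspos ht).le, hnorm,
      inv_mul_cancel₀ (hspos ht).ne']
  -- This `c` gives `√(2t + c) = √(2/a) * s t`, so the self-similar solution divided by `s t` is
  -- exactly the claimed limit, and the error is at most a constant over `s t`.
  · set c : ℝ := 2 / a * ‖x₀‖ ^ 2 with hc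
    have hy := isSolutionA_sqrt_smul hz hfix (c := c) (by positivity)
    rw [tendsto_iff_norm_sub_tendsto_zero]
    refine squeeze_zero' (Eventually.of_forall fun _ => norm_nonneg _) ?_
      (hstend.const_div_atTop ‖x₀ - Real.sqrt c • z‖)
    filter_upwards [eventually_ge_atTop 0] with t ht
    have hsq : Real.sqrt (2 / a) = (s t)⁻¹ * Real.sqrt (2 * t + c) := by
      rw [show 2 * t + c = 2 / a * (a * t + ‖x₀‖ ^ 2) by rw [hc]; field_simp,
        Real.sqrt_mul (by positivity), mul_comm, mul_assoc, mul_inv_cancel₀ (hspos ht).ne',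
        mul_one]
    rw [hsq, mul_smul, ← smul_sub, norm_smul, norm_inv, Real.norm_of_nonneg (hspos ht).le,
      inv_mul_eq_div]
    exact div_le_div_of_nonneg_right (hx.norm_sub_le hy ht) (hspos ht).le

end Flow

theorem mainTheorem7 (N : ℕ) (hN : 2 ≤ N) :
    ∃ z : EuclideanSpace ℝ (Fin N), IsOrderedHermiteZeros N z ∧
      ∀ x₀ ∈ openWeylChamberA N,
        (∃ x : ℝ → EuclideanSpace ℝ (Fin N), IsSolutionA N x₀ x) ∧
        (∀ x y : ℝ → EuclideanSpace ℝ (Fin N),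
          IsSolutionA N x₀ x → IsSolutionA N x₀ y → Set.EqOn x y (Set.Ici 0)) ∧
        ∀ x : ℝ → EuclideanSpace ℝ (Fin N), IsSolutionA N x₀ x →
          ∃ φ : ℝ → EuclideanSpace ℝ (Fin N),
            (∀ t : ℝ, 0 ≤ t →
              x t = Real.sqrt ((N : ℝ) * ((N : ℝ) - 1) * t + ‖x₀‖ ^ 2) • φ t ∧ ‖φ t‖ = 1) ∧
            Tendsto φ atTop (𝓝 (Real.sqrt (2 / ((N : ℝ) * ((N : ℝ) - 1))) • z)) := by
  obtain ⟨z, hz, hfix⟩ := exists_driftA_eq_self N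
  refine ⟨z, isOrderedHermiteZeros_of_driftA_eq hz hfix, fun x₀ hx₀ =>
    ⟨exists_isSolutionA hx₀, fun x y hx hy t ht => ?_, fun x hx =>
      hx.exists_direction hN hz hfix hx₀⟩⟩
  have := hx.norm_sub_le hy (t := t) ht
  rw [sub_self, norm_zero] at this
  exact sub_eq_zero.1 (norm_le_zero_iff.1 this)
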